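/- Let $m \ge 2$ and let $\mathcal F \subset \mathbb R^m$ be a finite set of vectors such that the matrix $\mathbf M(\mathcal F)$ is non-singular, where $\mathbf M(\mathcal S)=\sum_{\mathbf f\in\mathcal S}\mathbf f\mathbf f'$ for $\mathcal S\subseteq\mathcal F$. Put $\phi(\mathcal S)=\det(\mathbf M(\mathcal S))^{1/m}$. The modified Kumar–Yildirim method starts with $\mathcal S_0=\emptyset$ and, for $j=0,1,\dots,m-1$, takes a random direction (a nonzero vector) $\mathbf b$ orthogonal to all elements of $\mathcal S_j$, chooses $\mathbf f_{(j)}\in\mathcal F\setminus\mathcal S_j$ that maximizes $|\mathbf f'\mathbf b|$ over $\mathbf f\in\mathcal F\setminus\mathcal S_j$, and sets $\mathcal S_{j+1}=\mathcal S_j\cup\{\mathbf f_{(j)}\}$; its output is the $m$-element set $\mathcal S_{KY}=\mathcal S_m$. Let $\mathcal S^*$ be a $D$-optimal $m$-element subset of $\mathcal F$, i.e., one that maximizes $\phi$ among all $m$-element subsets of $\mathcal F$. Then, whatever directions are drawn and however ties are broken, $$\frac{\phi(\mathcal S_{KY})}{\phi(\mathcal S^*)}\;\ge\;\frac{\pi}{4m\,\Gamma(1+m/2)^{2/m}}\;\ge\;\frac{\pi}{2m^2}.$$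 -/

import Mathlib

namespace DOptSubset

noncomputable section

/-- The information matrix `M(S) = ∑_{f ∈ S} f fᵀ` of a finite set `S` of regressors in `ℝᵐ`. -/
def infoMatrix {m : ℕ} (S : Finset (EuclideanSpace ℝ (Fin m))) : Matrix (Fin m) (Fin m) ℝ :=
  ∑ f ∈ S, Matrix.vecMulVec (WithLp.ofLp f) (WithLp.ofLp f)

/-- The `D`-criterion `φ(S) = det(M(S))^{1/m}`. -/
def phi {m : ℕ} (S : Finset (EuclideanSpace ℝ (Fin m))) : ℝ :=
  (infoMatrix S).det ^ ((1 : ℝ) / (m : ℝ))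

/-- A set of regressors is non-singular if its information matrix is a non-singular matrix. -/
def IsNonsingular {m : ℕ} (S : Finset (EuclideanSpace ℝ (Fin m))) : Prop :=
  IsUnit (infoMatrix S)

/-- `S` is a `D`-optimal `s`-element subset of `F`: it maximizes `φ` among all `s`-element
subsets of `F`. -/
def IsDOptimal {m : ℕ} (F : Finset (EuclideanSpace ℝ (Fin m))) (s : ℕ)
    (S : Finset (EuclideanSpace ℝ (Fin m))) : Prop :=
  (S ⊆ F ∧ S.card = s) ∧
    ∀ T : Finset (EuclideanSpace ℝ (Fin m)), T ⊆ F → T.card = s → phi T ≤ phi S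

/-- The `D`-efficiency of `S₁` relative to `S₂`. -/
def relEff {m : ℕ} (S₁ S₂ : Finset (EuclideanSpace ℝ (Fin m))) : ℝ :=
  phi S₁ / phi S₂

open scoped Classical in
/-- `GreedyStage F sel j S` says that `S` is a possible value of the set `S_j` in the greedy
scheme on `F`: start with `S_0 = ∅`, then repeatedly add an element `f` of `F \ S_j` which the
selection rule `sel` allows for the current set `S_j`. -/
inductive GreedyStage {m : ℕ} (F : Finset (EuclideanSpace ℝ (Fin m)))
    (sel : Finset (EuclideanSpace ℝ (Fin m)) → EuclideanSpace ℝ (Fin m) → Prop) :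
    ℕ → Finset (EuclideanSpace ℝ (Fin m)) → Prop
  | start : GreedyStage F sel 0 ∅
  | step (j : ℕ) (S : Finset (EuclideanSpace ℝ (Fin m))) (f : EuclideanSpace ℝ (Fin m))
      (hS : GreedyStage F sel j S) (hf : f ∈ F \ S) (hsel : sel S f) :
      GreedyStage F sel (j + 1) (insert f S)

open scoped Classical in
/-- The selection rule of the modified Kumar–Yildirim method: for some direction `b` (a nonzero
vector) in the orthogonal complement of the span of `S`, the element `f` maximizes `|gᵀ b|`
over `g ∈ F \ S`. Every direction that can be drawn, and every way to break ties, is allowed. -/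
def KYSelect {m : ℕ} (F S : Finset (EuclideanSpace ℝ (Fin m)))
    (f : EuclideanSpace ℝ (Fin m)) : Prop :=
  ∃ b : EuclideanSpace ℝ (Fin m),
    b ∈ (Submodule.span ℝ (S : Set (EuclideanSpace ℝ (Fin m))))ᗮ ∧ b ≠ 0 ∧
      IsMaxOn (fun g => |inner ℝ g b|) ((F \ S : Finset _) : Set (EuclideanSpace ℝ (Fin m))) f

/-- `S` is a possible output of the modified Kumar–Yildirim method on `F ⊆ ℝᵐ`, that is, the set
`S_m` of some run of the greedy scheme with the Kumar–Yildirim selection rule. -/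
def IsKYOutput {m : ℕ} (F S : Finset (EuclideanSpace ℝ (Fin m))) : Prop :=
  GreedyStage F (KYSelect F) m S

end

end DOptSubset

/-! Let the rows of `A` be the selected vectors and those of `B` the drawn directions. Each
direction is orthogonal to the earlier selections, so `A * Bᵀ` is lower triangular, with diagonal
`d`. For an `m`-subset of `F` with row matrix `G`, maximality of the selections bounds column `k` of
`G * Bᵀ` by `|d k|`. After dividing columns by `d`, Hadamard's inequality gives `det G ^ 2 ≤ m ^ m *
det A ^ 2`, that is, efficiency at least `1 / m`. This is stronger than the Gamma bound, since `π ≤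
4` and `Γ (1 + m / 2) ≥ 1`. -/

/-- A form of Hadamard's inequality: a real `m × m` matrix with entries in `[-1, 1]` has squared
determinant at most `m ^ m`. -/
theorem Matrix.det_sq_le_of_abs_le_one {m : ℕ} (hm : 0 < m) (C : Matrix (Fin m) (Fin m) ℝ)
    (hC : ∀ i k, |C i k| ≤ 1) : C.det ^ 2 ≤ (m : ℝ) ^ m := by
  -- AM-GM on the eigenvalues of `Cᵀ * C`: their product is `det C ^ 2`, and their sum is the sum of
  -- the squared entries of `C`.
  have hpsd : (C.conjTranspose * C).PosSemidef := Matrix.posSemidef_conjTranspose_mul_self C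
  have hdet : C.det ^ 2 = ∏ i, hpsd.isHermitian.eigenvalues i := by
    have h := hpsd.isHermitian.det_eq_prod_eigenvalues
    rw [Matrix.det_mul, Matrix.det_conjTranspose] at h
    simpa [sq] using h
  have htr : ∑ i, hpsd.isHermitian.eigenvalues i ≤ (m : ℝ) * m := by
    have h := hpsd.isHermitian.trace_eq_sum_eigenvalues
    simp only [RCLike.ofReal_real_eq_id, id] at h
    rw [← h, Matrix.trace]
    calc ∑ i, (C.conjTranspose * C).diag i ≤ ∑ _i : Fin m, (m : ℝ) := by
          refine Finset.sum_le_sum fun i _ => ?_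
          rw [Matrix.diag_apply, Matrix.mul_apply]
          calc ∑ k, C.conjTranspose i k * C k i ≤ ∑ _k : Fin m, (1 : ℝ) := by
                refine Finset.sum_le_sum fun k _ => ?_
                rw [Matrix.conjTranspose_apply, star_trivial, ← sq, sq_le_one_iff_abs_le_one]
                exact hC k i
            _ = m := by simp
      _ = m * m := by simp
  have hm' : (0 : ℝ) < m := by exact_mod_cast hm
  have hnn := hpsd.eigenvalues_nonneg
  have hamgm := Real.geom_mean_le_arith_mean Finset.univ (fun _ : Fin m => (1 : ℝ))
    hpsd.isHermitian.eigenvalues (fun _ _ => zero_le_one) (by simpa using hm) (fun i _ => hnn i)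
  simp only [Real.rpow_one, one_mul, Finset.sum_const, Finset.card_univ, Fintype.card_fin,
    nsmul_eq_mul, mul_one] at hamgm
  rw [hdet]
  have hprod : 0 ≤ ∏ i, hpsd.isHermitian.eigenvalues i := Finset.prod_nonneg fun i _ => hnn i
  rw [← Real.rpow_natCast, ← Real.rpow_inv_le_iff_of_pos hprod hm'.le hm']
  exact hamgm.trans ((div_le_iff₀ hm').2 htr)

/-- `Γ (1 + m / 2) ≤ (m / 2) ^ (m / 2)` for integers `m ≥ 2`. -/
theorem Real.Gamma_one_add_half_le_rpow (m : ℕ) (hm : 2 ≤ m) :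
    Real.Gamma (1 + (m : ℝ) / 2) ≤ ((m : ℝ) / 2) ^ ((m : ℝ) / 2) := by
  induction m using Nat.strong_induction_on with
  | _ m ih =>
    -- Raising `m` by 2 shifts the Gamma argument by 1, so both parities need a base case.
    obtain rfl | rfl | h4 : m = 2 ∨ m = 3 ∨ 4 ≤ m := by omega
    · norm_num [Real.Gamma_two, one_add_one_eq_two]
    · have h1 : Real.Gamma (1 + ((3 : ℕ) : ℝ) / 2) = 3 / 4 * √Real.pi := by
        have e : (1 + ((3 : ℕ) : ℝ) / 2) = (1 / 2 + 1) + 1 := by norm_num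
        rw [e, Real.Gamma_add_one (by norm_num), Real.Gamma_add_one (by norm_num),
          Real.Gamma_one_half_eq]
        ring
      have h2 : √Real.pi ≤ 2 := by
        rw [Real.sqrt_le_left (by norm_num)]
        linarith [Real.pi_le_four]
      have h3 : (3 / 2 : ℝ) ≤ (((3 : ℕ) : ℝ) / 2) ^ (((3 : ℕ) : ℝ) / 2) := by
        push_cast
        exact Real.self_le_rpow_of_one_le (by norm_num) (by norm_num)
      rw [h1]
      linarith
    · obtain ⟨n, rfl⟩ : ∃ n, m = n + 2 := ⟨m - 2, by omega⟩
      have hn := ih n (by omega) (by omega)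
      have hn0 : (2 : ℝ) ≤ n := by exact_mod_cast (by omega : 2 ≤ n)
      have e : (((n + 2 : ℕ) : ℝ) / 2) = (n : ℝ) / 2 + 1 := by push_cast; ring
      rw [e, show 1 + ((n : ℝ) / 2 + 1) = (1 + (n : ℝ) / 2) + 1 by ring,
        Real.Gamma_add_one (by positivity), Real.rpow_add_one (by positivity),
        mul_comm, add_comm 1]
      rw [add_comm 1] at hn
      refine mul_le_mul_of_nonneg_right (hn.trans ?_) (by positivity)
      exact Real.rpow_le_rpow (by positivity) (by linarith) (by positivity)

/-- `Γ (1 + m / 2) ≥ 1` for integers `m ≥ 2`. -/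
theorem Real.one_le_Gamma_one_add_half (m : ℕ) (hm : 2 ≤ m) :
    1 ≤ Real.Gamma (1 + (m : ℝ) / 2) := by
  have hm' : (2 : ℝ) ≤ m := by exact_mod_cast hm
  refine Real.Gamma_two.symm.le.trans ?_
  exact Real.Gamma_strictMonoOn_Ici.monotoneOn (by simp) (by simp; linarith) (by linarith)

namespace DOptSubset

/-- The determinant of the information matrix of an injectively indexed set of `m` regressors is
the square of the determinant of the matrix with these regressors as rows. -/
theorem det_infoMatrix_image {m : ℕ} (g : Fin m → EuclideanSpace ℝ (Fin m))
    (hg : Function.Injective g) (S : Finset (EuclideanSpace ℝ (Fin m)))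
    (hS : ∀ x, x ∈ S ↔ ∃ i, g i = x) :
    (infoMatrix S).det = (Matrix.of fun i k => g i k).det ^ 2 := by
  have h : infoMatrix S = (Matrix.of fun i k => g i k).transpose * Matrix.of fun i k => g i k := by
    have hSi : S = Finset.univ.map ⟨g, hg⟩ := by ext x; simp [hS]
    ext a c
    rw [infoMatrix, hSi, Finset.sum_map, Matrix.sum_apply, Matrix.mul_apply]
    rfl
  rw [h, Matrix.det_mul, Matrix.det_transpose, sq]

/-- If the information matrix of `F` is non-singular, no nonzero vector is orthogonal to `F`. -/
theorem IsNonsingular.exists_inner_ne_zero {m : ℕ} {F : Finset (EuclideanSpace ℝ (Fin m))}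
    (hF : IsNonsingular F) {b : EuclideanSpace ℝ (Fin m)} (hb : b ≠ 0) :
    ∃ g ∈ F, inner ℝ g b ≠ 0 := by
  by_contra! h
  have h0 : (infoMatrix F).mulVec (WithLp.ofLp b) = 0 := by
    rw [infoMatrix, Matrix.sum_mulVec]
    refine Finset.sum_eq_zero fun g hg => ?_
    have hgb : WithLp.ofLp g ⬝ᵥ WithLp.ofLp b = 0 := by
      rw [← h g hg, dotProduct_comm, EuclideanSpace.inner_eq_star_dotProduct]
      simp
    rw [Matrix.vecMulVec_mulVec, hgb]
    simp
  have hinj := Matrix.mulVec_injective_iff_isUnit.mpr hF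
  apply hb
  have := hinj (h0.trans (Matrix.mulVec_zero _).symm)
  ext i
  exact congrFun this i

theorem GreedyStage.subset {m : ℕ} {F : Finset (EuclideanSpace ℝ (Fin m))}
    {sel : Finset (EuclideanSpace ℝ (Fin m)) → EuclideanSpace ℝ (Fin m) → Prop}
    {j : ℕ} {S : Finset (EuclideanSpace ℝ (Fin m))} (h : GreedyStage F sel j S) : S ⊆ F := by
  induction h with
  | start => exact Finset.empty_subset F
  | step j S x hS hx hsel ih => exact Finset.insert_subset (Finset.mem_sdiff.1 hx).1 ih

/-- The structure of a run of the Kumar–Yildirim scheme: the selected regressors `f i` and the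
directions `b i`, for `i < j`. -/
theorem GreedyStage.exists_directions {m : ℕ} {F : Finset (EuclideanSpace ℝ (Fin m))}
    {j : ℕ} {S : Finset (EuclideanSpace ℝ (Fin m))} (h : GreedyStage F (KYSelect F) j S) :
    ∃ f b : ℕ → EuclideanSpace ℝ (Fin m),
      (∀ x, x ∈ S ↔ ∃ i < j, f i = x) ∧
      (∀ k < j, b k ≠ 0) ∧ (∀ k < j, ∀ i < k, inner ℝ (f i) (b k) = 0 ∧ f i ≠ f k) ∧
      ∀ k < j, ∀ g ∈ F, |inner ℝ g (b k)| ≤ |inner ℝ (f k) (b k)| := by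
  induction h with
  -- Values at indices from `j` on are junk; each step overwrites index `j` only.
  | start => exact ⟨0, 0, by simp⟩
  | step j S x hS hx hsel ih =>
    obtain ⟨f, b, hfS, hb, hort, hmax⟩ := ih
    obtain ⟨c, hc, hc0, hcmax⟩ := hsel
    have hcS : ∀ y ∈ S, inner ℝ y c = 0 := fun y hy =>
      (Submodule.mem_orthogonal _ _).1 hc y (Submodule.subset_span hy)
    have hf : ∀ i < j, f i ∈ S := fun i hi => (hfS _).2 ⟨i, hi, rfl⟩
    refine ⟨Function.update f j x, Function.update b j c, ?_, ?_, ?_, ?_⟩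
    · intro y
      rw [Finset.mem_insert, hfS]
      constructor
      · rintro (rfl | ⟨i, hi, rfl⟩)
        · exact ⟨j, by omega, by simp⟩
        · exact ⟨i, by omega, by simp [hi.ne]⟩
      · rintro ⟨i, hi, rfl⟩
        obtain rfl | hij := eq_or_ne i j
        · simp
        · exact Or.inr ⟨i, by omega, by simp [hij]⟩
    · intro k hk
      obtain rfl | hkj := eq_or_ne k j
      · simpa
      · simpa [hkj] using hb k (by omega)
    · intro k hk i hik
      have hij : i ≠ j := by omega
      obtain rfl | hkj := eq_or_ne k j
      · simp only [Function.update_self, Function.update_of_ne hij]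
        refine ⟨hcS _ (hf i hik), ?_⟩
        rintro rfl
        exact (Finset.mem_sdiff.1 hx).2 (hf i hik)
      · simpa [hij, hkj] using hort k (by omega) i hik
    · intro k hk g hg
      obtain rfl | hkj := eq_or_ne k j
      · simp only [Function.update_self]
        -- Earlier selections have zero product with `c`, so the maximum over `F \ S` is one over
        -- all of `F`.
        by_cases hgS : g ∈ S
        · rw [hcS g hgS, abs_zero]
          exact abs_nonneg _
        · exact hcmax (by simpa using ⟨hg, hgS⟩)
      · simpa [hkj] using hmax k (by omega) g hg

/-- The output of the Kumar–Yildirim method is non-singular, and its determinant is within a factor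
`m ^ m` of that of any other `m`-element subset. -/
theorem IsKYOutput.det_infoMatrix_bound {m : ℕ} (hm : 0 < m)
    {F S : Finset (EuclideanSpace ℝ (Fin m))} (hF : IsNonsingular F) (hS : IsKYOutput F S) :
    S.card = m ∧ 0 < (infoMatrix S).det ∧
      ∀ T ⊆ F, T.card = m → (infoMatrix T).det ≤ (m : ℝ) ^ m * (infoMatrix S).det := by
  obtain ⟨f, b, hfS, hb, hort, hmax⟩ := GreedyStage.exists_directions hS
  have hinj : Function.Injective fun i : Fin m => f i := by
    intro i k hik
    rcases lt_trichotomy i k with h | h | h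
    · exact absurd hik (hort k k.2 i h).2
    · exact h
    · exact absurd hik.symm (hort i i.2 k h).2
  have hSmem : ∀ x, x ∈ S ↔ ∃ i : Fin m, f i = x := fun x => by
    rw [hfS]
    exact ⟨fun ⟨i, hi, h⟩ => ⟨⟨i, hi⟩, h⟩, fun ⟨i, h⟩ => ⟨i, i.2, h⟩⟩
  have hcard : S.card = m := by
    have : S = Finset.univ.map ⟨fun i : Fin m => f i, hinj⟩ := by ext x; simp [hSmem]
    rw [this, Finset.card_map, Finset.card_univ, Fintype.card_fin]
  set d : Fin m → ℝ := fun k => inner ℝ (f k) (b k) with hd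
  -- If `d k = 0`, maximality would make `b k` orthogonal to all of `F`.
  have hd0 : ∀ k, d k ≠ 0 := fun k hk => by
    obtain ⟨g, hg, hgb⟩ := hF.exists_inner_ne_zero (hb k k.2)
    have := hmax k k.2 g hg
    rw [show inner ℝ (f k) (b k) = 0 from hk, abs_zero] at this
    exact hgb (abs_nonpos_iff.1 this)
  set B : Matrix (Fin m) (Fin m) ℝ := Matrix.of fun i k => b i k with hB
  have hmul : ∀ (g : Fin m → EuclideanSpace ℝ (Fin m)) (i k : Fin m),
      ((Matrix.of fun i k => g i k) * B.transpose) i k = inner ℝ (g i) (b k) := by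
    intro g i k
    rw [Matrix.mul_apply, PiLp.inner_apply]
    refine Finset.sum_congr rfl fun l _ => ?_
    simp [hB, mul_comm]
  have hdetS : (Matrix.of fun i k : Fin m => f i k).det * B.det = ∏ k, d k := by
    rw [← Matrix.det_transpose B, ← Matrix.det_mul, Matrix.det_of_isLowerTriangular]
    · exact Finset.prod_congr rfl fun k _ => hmul (fun i => f i) k k
    · intro i k hik
      rw [hmul (fun i => f i)]
      exact (hort k k.2 i hik).1
  have hprod : ∏ k, d k ≠ 0 := Finset.prod_ne_zero_iff.2 fun k _ => hd0 k
  have hA0 : (Matrix.of fun i k : Fin m => f i k).det ≠ 0 := left_ne_zero_of_mul (hdetS ▸ hprod)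
  have hB0 : B.det ≠ 0 := right_ne_zero_of_mul (hdetS ▸ hprod)
  have hSdet := det_infoMatrix_image _ hinj S hSmem
  refine ⟨hcard, by rw [hSdet]; positivity, fun T hTF hT => ?_⟩
  let e : Fin m ≃ T := (T.equivFinOfCardEq hT).symm
  let g : Fin m → EuclideanSpace ℝ (Fin m) := fun i => (e i : EuclideanSpace ℝ (Fin m))
  have hTdet := det_infoMatrix_image g (Subtype.val_injective.comp e.injective) T fun x =>
    ⟨fun hx => ⟨e.symm ⟨x, hx⟩, by simp [g]⟩, by rintro ⟨i, rfl⟩; exact (e i).2⟩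
  -- Column `k` is scaled by `(d k)⁻¹`; the factor `det B` cancels through `hdetS`.
  have hhad := Matrix.det_sq_le_of_abs_le_one hm
    (Matrix.of fun i k => (d k)⁻¹ * ((Matrix.of fun i k => g i k) * B.transpose) i k) (by
      intro i k
      rw [Matrix.of_apply, hmul, abs_mul, abs_inv, inv_mul_le_one₀ (abs_pos.2 (hd0 k))]
      exact hmax k k.2 _ (hTF (e i).2))
  rw [Matrix.det_mul_row, Matrix.det_mul, Matrix.det_transpose, Finset.prod_inv_distrib, ← hdetS]
    at hhad
  rw [hSdet, hTdet]
  have hpos : 0 < (Matrix.of fun i k : Fin m => f i k).det ^ 2 := by positivity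
  rw [← div_le_iff₀ hpos]
  refine le_of_eq_of_le ?_ hhad
  field_simp

/-- The Kumar–Yildirim method has relative `D`-efficiency at least `1 / m`. -/
theorem IsKYOutput.one_div_le_relEff {m : ℕ} (hm : 0 < m)
    {F S T : Finset (EuclideanSpace ℝ (Fin m))} (hF : IsNonsingular F) (hS : IsKYOutput F S)
    (hT : T ⊆ F) (hTcard : T.card = m) (hle : phi S ≤ phi T) : 1 / (m : ℝ) ≤ relEff S T := by
  obtain ⟨-, hpos, hbound⟩ := hS.det_infoMatrix_bound hm hF
  have hphiS : 0 < phi S := Real.rpow_pos_of_pos hpos _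
  have hm' : (0 : ℝ) < m := by exact_mod_cast hm
  have hdetT : 0 ≤ (infoMatrix T).det := by
    let e : Fin m ≃ T := (T.equivFinOfCardEq hTcard).symm
    rw [det_infoMatrix_image (fun i => (e i : EuclideanSpace ℝ (Fin m)))
      (Subtype.val_injective.comp e.injective) T fun x =>
      ⟨fun hx => ⟨e.symm ⟨x, hx⟩, by simp⟩, by rintro ⟨i, rfl⟩; exact (e i).2⟩]
    positivity
  have h : phi T ≤ m * phi S := by
    calc phi T ≤ ((m : ℝ) ^ m * (infoMatrix S).det) ^ ((1 : ℝ) / (m : ℝ)) :=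
          Real.rpow_le_rpow hdetT (hbound T hT hTcard) (by positivity)
      _ = m * phi S := by
          rw [Real.mul_rpow (by positivity) hpos.le, one_div,
            Real.pow_rpow_inv_natCast hm'.le hm.ne', ← one_div, phi]
  -- `hle` serves only to make `phi T` positive.
  rw [relEff, div_le_div_iff₀ hm' (hphiS.trans_le hle)]
  linarith

end DOptSubset

theorem theorem3 (m : ℕ) (hm : 2 ≤ m) (F : Finset (EuclideanSpace ℝ (Fin m)))
    (hF : DOptSubset.IsNonsingular F) (S : Finset (EuclideanSpace ℝ (Fin m)))
    (hS : DOptSubset.IsKYOutput F S) (Sopt : Finset (EuclideanSpace ℝ (Fin m)))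
    (hSopt : DOptSubset.IsDOptimal F m Sopt) :
    Real.pi / (4 * (m : ℝ) * Real.Gamma (1 + (m : ℝ) / 2) ^ ((2 : ℝ) / (m : ℝ)))
        ≤ DOptSubset.relEff S Sopt ∧
      Real.pi / (2 * (m : ℝ) ^ 2)
        ≤ Real.pi / (4 * (m : ℝ) * Real.Gamma (1 + (m : ℝ) / 2) ^ ((2 : ℝ) / (m : ℝ))) := by
  have hm' : (0 : ℝ) < m := by exact_mod_cast (by omega : 0 < m)
  have hG1 := Real.one_le_Gamma_one_add_half m hm
  have hGlow : 1 ≤ Real.Gamma (1 + (m : ℝ) / 2) ^ ((2 : ℝ) / (m : ℝ)) :=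
    Real.one_le_rpow hG1 (by positivity)
  have hGup : Real.Gamma (1 + (m : ℝ) / 2) ^ ((2 : ℝ) / (m : ℝ)) ≤ (m : ℝ) / 2 := by
    calc Real.Gamma (1 + (m : ℝ) / 2) ^ ((2 : ℝ) / (m : ℝ))
        ≤ (((m : ℝ) / 2) ^ ((m : ℝ) / 2)) ^ ((2 : ℝ) / (m : ℝ)) :=
          Real.rpow_le_rpow (by linarith) (Real.Gamma_one_add_half_le_rpow m hm) (by positivity)
      _ = (m : ℝ) / 2 := by
          rw [← Real.rpow_mul (by positivity), div_mul_div_cancel₀ (by norm_num),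
            div_self hm'.ne', Real.rpow_one]
  constructor
  · have hSF : S ⊆ F := DOptSubset.GreedyStage.subset hS
    have hScard := (hS.det_infoMatrix_bound (by omega) hF).1
    refine le_trans ?_ (hS.one_div_le_relEff (by omega) hF hSopt.1.1 hSopt.1.2
      (hSopt.2 S hSF hScard))
    -- What remains is `π * m ≤ 4 * m * Γ (1 + m / 2) ^ (2 / m)`.
    rw [div_le_div_iff₀ (by positivity) hm']
    nlinarith [Real.pi_le_four, mul_le_mul_of_nonneg_left hGlow hm'.le]
  · refine div_le_div_of_nonneg_left Real.pi_pos.le (by positivity) ?_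
    nlinarith [mul_le_mul_of_nonneg_left hGup hm'.le]
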